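/- **Model.** A job $j$ has a volume $v_j\ge 0$ and a resource requirement $r_j\in(0,1]$. A feasible schedule for a finite sequence of jobs $J=[n]=(1,\dots,n)$ consists of integrable functions $R_j\colon[0,\infty)\to[0,1]$, $j\in[n]$, with $\bar R(t):=\sum_j R_j(t)\le 1$ and $R_j(t)\le r_j$ for all $t\ge 0$, and $\int_0^\infty R_j(t)\,dt\ge v_j$ for all $j$. The completion time of $j$ is $C_j(R)=\sup\{t\ge 0: R_j(t)>0\}\in[0,\infty]$, the makespan is $M(R)=\max_j C_j(R)$ (and $0$ if $n=0$), and $M^*(J)$ is the infimum of $M(R)$ over all feasible schedules $R$ for $J$. A deterministic online algorithm $\mathcal A$ receives the jobs one after another and fixes $R_j$ as a function of jobs $1,\dots,j$ only; $\mathcal A(J)$ is the resulting schedule. It is $c$-competitive if, for every finite sequence of jobs $J$, $\mathcal A(J)$ is feasible and $M(\mathcal A(J))\le c\cdot M^*(J)$; its competitive ratio is the least such $c$. **Water-filling.** Let $R$ be a schedule for some jobs, $\iota$ a new job and $C\ge0$ a target completion time. For $h\in[0,1]$ let $\mathrm{wl}_h(t)=\min\{r_\iota,\max\{h-\bar R(t),0\}\}$.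 The water-filling step for $(R,\iota,C)$ succeeds if $\int_0^C \mathrm{wl}_1(t)\,dt\ge v_\iota$; it then adds to $R$ the assignment $R_\iota(t)=\mathrm{wl}_{h^*}(t)$ for $0\le t<C$, $R_\iota(t)=0$ for $t\ge C$, where $h^*=\inf\{h\in[0,1]:\int_0^C \mathrm{wl}_h(t)\,dt\ge v_\iota\}$. The water-filling algorithm starts with the empty schedule and, on arrival of job $j$, performs the water-filling step for $j$ with target completion time $H_j=\frac{e}{e-1}\,M^*([j])$ on the schedule computed for $[j-1]$. **Theorem.** 1. On every finite sequence of jobs, all steps of the water-filling algorithm succeed, and the algorithm has competitive ratio $\frac{e}{e-1}$ for the makespan. 2. No deterministic online algorithm has a smaller competitive ratio: if a deterministic online algorithm is $c$-competitive, then $c\ge\frac{e}{e-1}$. More precisely, for every $c<\frac{e}{e-1}$ there is an $N$ such that for all $n\ge N$ and every deterministic online algorithm $\mathcal A$ that always computes feasible schedules, there is a $k\le n$ such that $M(\mathcal A([k]))>c\cdot M^*([k])$ for the jobs $1,\dots,n$ with $v_j=1/n$ and $r_j=1/j$. -/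

import Mathlib

open MeasureTheory

noncomputable section

namespace SharedResource

/-- A job: it has to receive the amount `vol` of the resource in total, and it can use at most the
fraction `req` of the resource at any time. -/
structure Job where
  vol : ℝ
  req : ℝ
  vol_nonneg : 0 ≤ vol
  req_pos : 0 < req
  req_le_one : req ≤ 1

/-- A resource assignment for each of `n` jobs, as a function of time. Time is `[0, ∞)`: the values
at negative arguments play no role anywhere. -/
abbrev Schedule (n : ℕ) : Type := Fin n → ℝ → ℝ

/-- The total resource usage at time `t`. -/
def Schedule.usage {n : ℕ} (R : Schedule n) (t : ℝ) : ℝ := ∑ j, R j t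

/-- Feasibility of a schedule for the sequence of jobs `J`. -/
structure IsFeasible (J : List Job) (R : Schedule J.length) : Prop where
  integrable : ∀ j, IntegrableOn (R j) (Set.Ici 0)
  nonneg : ∀ j, ∀ t : ℝ, 0 ≤ t → 0 ≤ R j t
  usage_le_one : ∀ t : ℝ, 0 ≤ t → R.usage t ≤ 1
  le_req : ∀ j, ∀ t : ℝ, 0 ≤ t → R j t ≤ (J.get j).req
  vol_le : ∀ j, (J.get j).vol ≤ ∫ t in Set.Ici 0, R j t

/-- The completion time of a job with resource assignment `f`: the supremum of the times `t ≥ 0`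
with `f t > 0`, taken in `[0, ∞]`. -/
def completionTime (f : ℝ → ℝ) : ENNReal :=
  ⨆ (t : ℝ) (_ : 0 ≤ t ∧ 0 < f t), ENNReal.ofReal t

/-- The makespan: the largest completion time (`0` if there is no job). -/
def Schedule.makespan {n : ℕ} (R : Schedule n) : ENNReal :=
  ⨆ j, completionTime (R j)

/-- The optimal (offline) makespan of a sequence of jobs. -/
def optMakespan (J : List Job) : ENNReal :=
  ⨅ (R : Schedule J.length) (_ : IsFeasible J R), R.makespan

/-- A deterministic online (list-scheduling) algorithm: the resource assignment of a job is
a function of that job and of the list of the jobs that arrived before it. -/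
abbrev OnlineAlgorithm : Type := List Job → Job → ℝ → ℝ

/-- The schedule that an online algorithm produces for the sequence of jobs `J`. -/
def OnlineAlgorithm.schedule (A : OnlineAlgorithm) (J : List Job) : Schedule J.length :=
  fun j => A (J.take j) (J.get j)

/-- `A` is `c`-competitive: on every sequence of jobs it computes a feasible schedule whose makespan
is at most `c` times the optimal one. -/
def OnlineAlgorithm.IsCompetitive (A : OnlineAlgorithm) (c : ℝ) : Prop :=
  ∀ J : List Job, IsFeasible J (A.schedule J) ∧
    (A.schedule J).makespan ≤ ENNReal.ofReal c * optMakespan J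

/-- The (worst-case) competitive ratio of `A` is `ρ`. -/
def OnlineAlgorithm.HasCompetitiveRatio (A : OnlineAlgorithm) (ρ : ℝ) : Prop :=
  IsLeast {c : ℝ | A.IsCompetitive c} ρ

/-- The `h`-water-level for the job `ι` on top of the total resource usage `u`. -/
def waterLevel (u : ℝ → ℝ) (ι : Job) (h t : ℝ) : ℝ := min ι.req (max (h - u t) 0)

/-- The water-filling step for `ι` with target completion time `C` succeeds: the resource left over
before time `C` suffices to complete `ι`. -/
def StepSucceeds (u : ℝ → ℝ) (ι : Job) (C : ℝ) : Prop :=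
  ι.vol ≤ ∫ t in (0 : ℝ)..C, waterLevel u ι 1 t

/-- The smallest water level at which `ι` can be completed by time `C`. -/
def stepLevel (u : ℝ → ℝ) (ι : Job) (C : ℝ) : ℝ :=
  sInf {h : ℝ | h ∈ Set.Icc 0 1 ∧ ι.vol ≤ ∫ t in (0 : ℝ)..C, waterLevel u ι h t}

/-- The resource assignment that the water-filling step gives to `ι`: up to the target completion
time `C`, the water level `stepLevel`; afterwards nothing. (It is meaningful only if the step
succeeds.) -/
def stepAssignment (u : ℝ → ℝ) (ι : Job) (C t : ℝ) : ℝ :=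
  if t < C then waterLevel u ι (stepLevel u ι C) t else 0

/-- The target completion time of the job `ι` that arrives after the jobs `past`: `c` times the
optimal makespan of all jobs that have arrived by then. -/
def targetTime (c : ℝ) (past : List Job) (ι : Job) : ℝ :=
  c * (optMakespan (past ++ [ι])).toReal

/-- The water-filling algorithm with target completion times `c * M*`: each new job is added by a
water-filling step to the schedule that the algorithm computed for the earlier jobs. -/
def waterFilling (c : ℝ) (past : List Job) (ι : Job) : ℝ → ℝ :=
  stepAssignment (fun t => ∑ i : Fin past.length, waterFilling c (past.take i) (past.get i) t)
    ι (targetTime c past ι)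
termination_by past.length
decreasing_by simp

theorem waterFilling_eq (c : ℝ) (past : List Job) (ι : Job) :
    waterFilling c past ι =
      stepAssignment (OnlineAlgorithm.schedule (waterFilling c) past).usage ι
        (targetTime c past ι) := by
  rw [waterFilling]
  rfl

/-- The sequence of `n` jobs of which the `j`-th, `j = 1, …, n`, has volume `1 / n` and
requirement `1 / j`. -/
def harmonicJobs (n : ℕ) : List Job :=
  List.ofFn fun i : Fin n =>
    { vol := 1 / (n : ℝ)
      req := 1 / ((i : ℝ) + 1)
      vol_nonneg := by positivity
      req_pos := by positivity
      req_le_one := by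
        rw [div_le_one (by positivity)]
        exact le_add_of_nonneg_left (Nat.cast_nonneg _) }

end SharedResource

end

/-!
Write `κ = e / (e - 1)`. With fluid resource assignments the optimal makespan is simply the larger
of the total volume and the largest `vol / req`: each job can run at a constant rate. Only this
description of the optimum is used.

*Upper bound.* Let `u` be the resource usage of a water-filled schedule of total volume `V`. The
invariant `IsBalanced` says that the volume `∫ (u - y)⁺` above any level `y ∈ [0, 1]` is at most
`V * (1 - κ (1 - exp (-y)))`. A job of requirement `r` can use everything before its target time `H`
except for the volume above the level `1 - r`, so the invariant makes the step succeed
(`IsBalanced.stepSucceeds`). The step with water level `h` replaces `u` on `[0, H)` by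
`min (u + r) (max h u)`. Hence the volume above `y` is unchanged if `h ≤ y`; it is everything
but `y * H` if `y < r` and `y < h`; and for `r ≤ y < h` it is the old volume above `y - r` plus
`vol - r * H`. Thus the invariant persists (`IsBalanced.add_stepAssignment`). The last case and the
success of the step both rest on `ratio_mul_le_of_target`, whose core is `exp r * (1 - r) ≤ 1`.

*Lower bound.* For the jobs with volume `1 / n` and requirement `1 / j`, the first `k` jobs have
optimal makespan at most `k / n`. If an algorithm stays within `c` times the optimum on all prefixes,
job `j` is finished by time `c * j / n`, so by time `T = c - 1` it has received at least
`(1 - c) / n + T / j`, and all of `1 / n` if `c * j / n ≤ T`. The sum over all jobs is at most `T`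
(`sum_harmonic_le`); as `n` grows it tends to `T * log (c / (c - 1))`, so that `c ≥ κ`.
-/

namespace SharedResource

open Set

/-! ### The optimal makespan -/

theorem le_makespan {n : ℕ} (R : Schedule n) (j : Fin n) {t : ℝ} (ht : 0 ≤ t) (h : 0 < R j t) :
    ENNReal.ofReal t ≤ R.makespan :=
  (le_iSup₂_of_le (f := fun (s : ℝ) (_ : 0 ≤ s ∧ 0 < R j s) => ENNReal.ofReal s)
    t ⟨ht, h⟩ le_rfl).trans (le_iSup (fun j => completionTime (R j)) j)

theorem completionTime_le {f : ℝ → ℝ} {B : ℝ} (h : ∀ t, B < t → f t ≤ 0) :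
    completionTime f ≤ ENNReal.ofReal B := by
  refine iSup₂_le fun t ht => ENNReal.ofReal_le_ofReal ?_
  by_contra! hlt
  exact absurd ht.2 (not_lt.mpr (h t hlt))

theorem eq_zero_of_makespan_le {J : List Job} {R : Schedule J.length} (hR : IsFeasible J R) {B : ℝ}
    (hB : 0 ≤ B) (h : R.makespan ≤ ENNReal.ofReal B) (j : Fin J.length) {t : ℝ} (ht : B < t) :
    R j t = 0 := by
  have ht0 : 0 ≤ t := hB.trans ht.le
  by_contra hne
  have hpos := lt_of_le_of_ne (hR.nonneg j t ht0) (Ne.symm hne)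
  have := (ENNReal.ofReal_le_ofReal_iff hB).mp ((le_makespan R j ht0 hpos).trans h)
  linarith

/-- A function bounded by `r` that vanishes after time `B` gets at most `r * (B - T)⁺` after
time `T`. -/
theorem setIntegral_Ici_le_add {f : ℝ → ℝ} {r T B : ℝ} (hf : IntegrableOn f (Ici 0)) (hr : 0 ≤ r)
    (hT : 0 ≤ T) (hle : ∀ t, 0 ≤ t → f t ≤ r) (h0 : ∀ t, 0 ≤ t → B < t → f t = 0) :
    ∫ t in Ici 0, f t ≤ (∫ t in Icc 0 T, f t) + r * max (B - T) 0 := by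
  have hsplit : Ici (0 : ℝ) = Icc 0 T ∪ Ioi T := (Icc_union_Ioi_eq_Ici hT).symm
  have hf1 : IntegrableOn f (Icc 0 T) := hf.mono_set Icc_subset_Ici_self
  have hf2 : IntegrableOn f (Ioi T) := hf.mono_set fun t ht => hT.trans (le_of_lt ht)
  have hdisj : Disjoint (Icc 0 T) (Ioi T) :=
    Set.disjoint_left.mpr fun t ht ht' => not_lt.mpr ht.2 ht'
  rw [hsplit, setIntegral_union hdisj measurableSet_Ioi hf1 hf2]
  gcongr
  calc ∫ t in Ioi T, f t ≤ ∫ t in Ioi T, (Ioc T B).indicator (fun _ => r) t := by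
        refine setIntegral_mono_on hf2 ?_ measurableSet_Ioi fun t ht => ?_
        · exact ((integrableOn_const (by simp)).integrable_indicator measurableSet_Ioc).integrableOn
        · have ht0 : 0 ≤ t := hT.trans (le_of_lt ht)
          by_cases htB : t ≤ B
          · rw [indicator_of_mem (show t ∈ Ioc T B from ⟨ht, htB⟩)]
            exact hle t ht0
          · rw [h0 t ht0 (not_le.mp htB)]
            exact indicator_nonneg (fun _ _ => hr) t
    _ = ∫ t in Ioc T B, r := by
        rw [setIntegral_indicator measurableSet_Ioc,
          inter_eq_right.mpr (fun t ht => ht.1)]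
    _ = r * max (B - T) 0 := by
        simp [mul_comm]

/-- The total volume of a sequence of jobs. -/
def totalVol (J : List Job) : ℝ := (J.map Job.vol).sum

theorem totalVol_append_singleton (past : List Job) (ι : Job) :
    totalVol (past ++ [ι]) = totalVol past + ι.vol := by
  simp [totalVol]

theorem totalVol_nonneg (J : List Job) : 0 ≤ totalVol J := by
  refine List.sum_nonneg fun x hx => ?_
  obtain ⟨j, -, rfl⟩ := List.mem_map.mp hx
  exact j.vol_nonneg

theorem sum_vol_eq_totalVol (J : List Job) : ∑ j, (J.get j).vol = totalVol J := by
  rw [totalVol, ← Fin.sum_univ_fun_getElem]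
  rfl

/-- Every job needs time `vol / req`, and all jobs together need time `totalVol`. -/
theorem optMakespan_lower_bounds (J : List Job) {B : ℝ} (hB : 0 ≤ B)
    (h : optMakespan J ≤ ENNReal.ofReal B) :
    totalVol J ≤ B ∧ ∀ ι ∈ J, ι.vol ≤ ι.req * B := by
  -- the infimum may not be attained, but every `B' > B` exceeds the makespan of a feasible schedule
  suffices H : ∀ B' > B, totalVol J ≤ B' ∧ ∀ ι ∈ J, ι.vol ≤ ι.req * B' by
    refine ⟨le_of_forall_gt_imp_ge_of_dense fun B' hB' => (H B' hB').1, fun ι hι => ?_⟩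
    rw [← div_le_iff₀' ι.req_pos]
    exact le_of_forall_gt_imp_ge_of_dense fun B' hB' =>
      (div_le_iff₀' ι.req_pos).mpr ((H B' hB').2 ι hι)
  intro B' hB'
  have hB'0 : 0 < B' := hB.trans_lt hB'
  have hlt : optMakespan J < ENNReal.ofReal B' :=
    h.trans_lt ((ENNReal.ofReal_lt_ofReal_iff hB'0).mpr hB')
  simp only [optMakespan, iInf_lt_iff] at hlt
  obtain ⟨R, hR, hM⟩ := hlt
  have hz := fun j t (ht : B' < t) => eq_zero_of_makespan_le hR hB'0.le hM.le j ht
  constructor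
  · calc totalVol J = ∑ j, (J.get j).vol := (sum_vol_eq_totalVol J).symm
      _ ≤ ∑ j, ∫ t in Ici 0, R j t := Finset.sum_le_sum fun j _ => hR.vol_le j
      _ = ∫ t in Ici 0, R.usage t :=
          (integral_finsetSum _ fun j _ => hR.integrable j).symm
      _ ≤ (∫ t in Icc 0 0, R.usage t) + 1 * max (B' - 0) 0 :=
          setIntegral_Ici_le_add (integrable_finsetSum _ fun j _ => hR.integrable j) zero_le_one
            le_rfl hR.usage_le_one fun t _ ht => Finset.sum_eq_zero fun j _ => hz j t ht
      _ = B' := by simp [hB'0.le]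
  · intro ι hι
    obtain ⟨j, rfl⟩ := List.get_of_mem hι
    calc (J.get j).vol ≤ ∫ t in Ici 0, R j t := hR.vol_le j
      _ ≤ (∫ t in Icc 0 0, R j t) + (J.get j).req * max (B' - 0) 0 :=
          setIntegral_Ici_le_add (hR.integrable j) (J.get j).req_pos.le le_rfl (hR.le_req j)
            fun t _ ht => hz j t ht
      _ = (J.get j).req * B' := by simp [hB'0.le]

/-- Running every job at the constant rate `vol / M` until time `M` gives makespan `M`. -/
theorem optMakespan_le (J : List Job) {M : ℝ} (hM : 0 ≤ M) (hV : totalVol J ≤ M)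
    (hp : ∀ ι ∈ J, ι.vol ≤ ι.req * M) : optMakespan J ≤ ENNReal.ofReal M := by
  set R : Schedule J.length := fun j => (Icc 0 M).indicator fun _ => (J.get j).vol / M with hRdef
  have hfeas : IsFeasible J R := by
    refine ⟨fun j => ?_, fun j t _ => ?_, fun t _ => ?_, fun j t _ => ?_, fun j => ?_⟩
    · exact ((integrableOn_const (by simp)).integrable_indicator measurableSet_Icc).integrableOn
    · exact indicator_nonneg (fun _ _ => div_nonneg (J.get j).vol_nonneg hM) t
    · by_cases ht : t ∈ Icc 0 M
      · simp only [Schedule.usage, hRdef, indicator_of_mem ht]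
        rw [← Finset.sum_div, sum_vol_eq_totalVol]
        exact div_le_one_of_le₀ hV hM
      · simp only [Schedule.usage, hRdef, indicator_of_notMem ht]
        simp
    · refine indicator_le' (fun _ _ => ?_) (fun _ _ => (J.get j).req_pos.le) t
      exact div_le_of_le_mul₀ hM (J.get j).req_pos.le (hp _ (J.get_mem j))
    · rw [hRdef, setIntegral_indicator measurableSet_Icc,
        inter_eq_right.mpr Icc_subset_Ici_self]
      rcases hM.eq_or_lt with rfl | hM0
      · simpa using hp _ (J.get_mem j)
      · simp [hM0.le, hM0.ne', mul_div_cancel₀]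
  refine (iInf₂_le R hfeas).trans (iSup_le fun j => completionTime_le fun t ht => ?_)
  rw [hRdef]
  simp only [indicator_of_notMem (show t ∉ Icc 0 M from fun h => not_lt.mpr h.2 ht)]
  exact le_rfl

theorem optMakespan_ne_top (J : List Job) : optMakespan J ≠ ⊤ := by
  have hs : ∀ ι ∈ J, ι.vol / ι.req ≤ (J.map fun ι => ι.vol / ι.req).sum := fun ι hι =>
    List.single_le_sum (by
      intro x hx
      obtain ⟨j, -, rfl⟩ := List.mem_map.mp hx
      exact div_nonneg j.vol_nonneg j.req_pos.le) _ (List.mem_map_of_mem hι)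
  have hs0 : 0 ≤ (J.map fun ι => ι.vol / ι.req).sum := List.sum_nonneg fun x hx => by
    obtain ⟨j, -, rfl⟩ := List.mem_map.mp hx
    exact div_nonneg j.vol_nonneg j.req_pos.le
  have hV := totalVol_nonneg J
  refine ne_top_of_le_ne_top ENNReal.ofReal_ne_top
    (optMakespan_le J (M := totalVol J + (J.map fun ι => ι.vol / ι.req).sum)
      (by positivity) (by linarith) fun ι hι => ?_)
  rw [← div_le_iff₀' ι.req_pos]
  linarith [hs ι hι]

theorem totalVol_le_optMakespan (J : List Job) : totalVol J ≤ (optMakespan J).toReal :=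
  (optMakespan_lower_bounds J ENNReal.toReal_nonneg
    (ENNReal.ofReal_toReal (optMakespan_ne_top J)).ge).1

theorem vol_le_req_mul_optMakespan (J : List Job) {ι : Job} (hι : ι ∈ J) :
    ι.vol ≤ ι.req * (optMakespan J).toReal :=
  (optMakespan_lower_bounds J ENNReal.toReal_nonneg
    (ENNReal.ofReal_toReal (optMakespan_ne_top J)).ge).2 ι hι

theorem optMakespan_append_mono (J K : List Job) :
    (optMakespan J).toReal ≤ (optMakespan (J ++ K)).toReal := by
  refine ENNReal.toReal_le_of_le_ofReal ENNReal.toReal_nonneg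
    (optMakespan_le J ENNReal.toReal_nonneg ?_ fun ι hι =>
      vol_le_req_mul_optMakespan _ (List.mem_append_left K hι))
  refine le_trans ?_ (totalVol_le_optMakespan (J ++ K))
  have := totalVol_nonneg K
  simp only [totalVol, List.map_append, List.sum_append] at this ⊢
  linarith

theorem usage_schedule_append_singleton (A : OnlineAlgorithm) (past : List Job) (ι : Job) (t : ℝ) :
    (A.schedule (past ++ [ι])).usage t = (A.schedule past).usage t + A past ι t := by
  have hlen : past.length + 1 = (past ++ [ι]).length := by simp
  simp only [Schedule.usage, OnlineAlgorithm.schedule]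
  rw [← Fin.sum_congr' _ hlen, Fin.sum_univ_castSucc]
  congr 1
  · refine Finset.sum_congr rfl fun i _ => ?_
    simp [List.take_append_of_le_length i.2.le]
  · simp

/-! ### Water-filling -/

/-- The competitive ratio `e / (e - 1)`, written `κ` in comments. -/
noncomputable def ratio : ℝ := Real.exp 1 / (Real.exp 1 - 1)

theorem one_lt_exp_one : 1 < Real.exp 1 := by
  linarith [Real.add_one_lt_exp (one_ne_zero (α := ℝ))]

theorem one_lt_ratio : 1 < ratio := by
  rw [ratio, one_lt_div (by linarith [one_lt_exp_one])]
  linarith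

theorem ratio_mul_one_sub_exp_neg_one : ratio * (1 - Real.exp (-1)) = 1 := by
  have h := one_lt_exp_one
  have h1 : Real.exp 1 - 1 ≠ 0 := by linarith
  rw [ratio, Real.exp_neg]
  field_simp

/-- The bound `1 - κ (1 - exp (-y))`, with `κ = e / (e - 1)`, on the fraction of the total volume
that water-filling places above the level `y`. It decreases from `1` at `y = 0` to `0` at `y = 1`
and is attained by the profile `min 1 (log (κ V / t))` on `(0, κ V)`, of total volume `V`. -/
noncomputable def excessBound (y : ℝ) : ℝ := 1 - ratio * (1 - Real.exp (-y))

theorem excessBound_nonneg {y : ℝ} (hy : y ≤ 1) : 0 ≤ excessBound y := by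
  have h1 : Real.exp (-1) ≤ Real.exp (-y) := Real.exp_le_exp.mpr (by linarith)
  have h2 := ratio_mul_one_sub_exp_neg_one
  have h3 := one_lt_ratio
  unfold excessBound
  nlinarith

theorem exp_mul_one_sub_le_one (r : ℝ) : Real.exp r * (1 - r) ≤ 1 := by
  have h := mul_le_mul_of_nonneg_left (Real.add_one_le_exp (-r)) (Real.exp_pos r).le
  rw [← Real.exp_add, add_neg_cancel, Real.exp_zero] at h
  linarith

/-- The inequality behind the competitive ratio: `H` is the target time of a job with volume `v` and
requirement `r` that arrives when a volume `V` has been scheduled. -/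
theorem ratio_mul_le_of_target {V v r H y : ℝ} (hv : 0 ≤ v) (hr : 0 < r) (hry : r ≤ y)
    (hH : ratio * (V + v) ≤ H) (hH' : ratio * v ≤ r * H) :
    ratio * (V * Real.exp (-y) * (Real.exp r - 1) + v * (1 - Real.exp (-y))) ≤ r * H := by
  have hκ : 0 < ratio := zero_lt_one.trans one_lt_ratio
  obtain ⟨S, rfl⟩ : ∃ S, H = ratio * S / r := ⟨r * H / ratio, by field_simp⟩
  have h1 : (V + v) * r ≤ S := by
    rw [le_div_iff₀ hr] at hH
    nlinarith
  have hS : r * (ratio * S / r) = ratio * S := by field_simp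
  rw [hS] at hH' ⊢
  have h2 : v ≤ S := le_of_mul_le_mul_left hH' hκ
  refine mul_le_mul_of_nonneg_left ?_ hκ.le
  set E := Real.exp r
  set Y := Real.exp (-y)
  have hY : 0 < Y := Real.exp_pos _
  have hE : 1 ≤ E := by linarith [Real.add_one_le_exp r]
  have hE' : E * (1 - r) ≤ 1 := exp_mul_one_sub_le_one r
  have hYE : Y * E ≤ 1 := by
    rw [← Real.exp_add, Real.exp_le_one_iff]
    linarith
  -- after multiplication by `r`, the bounds on `r * V` and on `v` reduce this to `E * (1 - r) ≤ 1`
  refine le_of_mul_le_mul_left ?_ hr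
  have a1 : Y * (E - 1) * (r * V) ≤ Y * (E - 1) * (S - r * v) :=
    mul_le_mul_of_nonneg_left (by linarith) (mul_nonneg hY.le (by linarith))
  have a2 : r * (1 - Y * E) * v ≤ r * (1 - Y * E) * S :=
    mul_le_mul_of_nonneg_left h2 (mul_nonneg hr.le (by linarith))
  have a3 : S * Y * (E * (1 - r)) ≤ S * Y * 1 :=
    mul_le_mul_of_nonneg_left hE' (mul_nonneg (hv.trans h2) hY.le)
  linarith

/-- The invariant of water-filling: `u` is a usage profile of total volume `V` that vanishes from
time `K` on, and for every level `y` the volume above `y` is at most the fraction `excessBound y` of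
the total volume. -/
structure IsBalanced (u : ℝ → ℝ) (V K : ℝ) : Prop where
  measurable : Measurable u
  nonneg : ∀ t, 0 ≤ t → 0 ≤ u t
  le_one : ∀ t, 0 ≤ t → u t ≤ 1
  eq_zero : ∀ t, 0 ≤ t → K ≤ t → u t = 0
  integral_eq : ∀ T, K ≤ T → ∫ t in (0 : ℝ)..T, u t = V
  integral_excess_le : ∀ T, K ≤ T → ∀ y, 0 ≤ y → y ≤ 1 →
    ∫ t in (0 : ℝ)..T, max (u t - y) 0 ≤ V * excessBound y

/-- A measurable function with values in a bounded interval is interval integrable. -/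
theorem intervalIntegrable_of_bounded {f : ℝ → ℝ} {T a b : ℝ} (hf : Measurable f) (hT : 0 ≤ T)
    (ha : ∀ t, 0 ≤ t → a ≤ f t) (hb : ∀ t, 0 ≤ t → f t ≤ b) :
    IntervalIntegrable f volume 0 T := by
  rw [intervalIntegrable_iff_integrableOn_Ioc_of_le hT]
  refine Measure.integrableOn_of_bounded (M := max |a| |b|) (by simp) hf.aestronglyMeasurable ?_
  filter_upwards [ae_restrict_mem measurableSet_Ioc] with t ht
  exact abs_le_max_abs_abs (ha t ht.1.le) (hb t ht.1.le)

section Step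

variable {u : ℝ → ℝ} {ι : Job}

theorem measurable_waterLevel (hu : Measurable u) (h : ℝ) : Measurable (waterLevel u ι h) := by
  unfold waterLevel
  fun_prop

theorem waterLevel_nonneg (h t : ℝ) : 0 ≤ waterLevel u ι h t :=
  le_min ι.req_pos.le (le_max_right _ _)

theorem waterLevel_le_req (h t : ℝ) : waterLevel u ι h t ≤ ι.req := min_le_left _ _

theorem waterLevel_mono {h h' : ℝ} (hh : h ≤ h') (t : ℝ) :
    waterLevel u ι h t ≤ waterLevel u ι h' t := by
  unfold waterLevel
  gcongr

theorem intervalIntegrable_waterLevel (hu : Measurable u) (h : ℝ) {H : ℝ} (hH : 0 ≤ H) :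
    IntervalIntegrable (waterLevel u ι h) volume 0 H :=
  intervalIntegrable_of_bounded (measurable_waterLevel hu h) hH
    (fun _ _ => waterLevel_nonneg _ _) (fun _ _ => waterLevel_le_req _ _)

theorem continuous_integral_waterLevel (hu : Measurable u) (H : ℝ) :
    Continuous fun h => ∫ t in (0 : ℝ)..H, waterLevel u ι h t := by
  refine intervalIntegral.continuous_of_dominated_interval (bound := fun _ => ι.req)
    (fun h => (measurable_waterLevel hu h).aestronglyMeasurable) (fun h => ?_) (by simp) ?_
  · refine Filter.Eventually.of_forall fun t _ => ?_
    rw [Real.norm_of_nonneg (waterLevel_nonneg _ _)]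
    exact waterLevel_le_req _ _
  · refine Filter.Eventually.of_forall fun t _ => ?_
    unfold waterLevel
    fun_prop

/-- If the step succeeds, the level it picks is admissible and fills in exactly the volume of
the job. -/
theorem StepSucceeds.stepLevel_spec {H : ℝ} (hs : StepSucceeds u ι H) (hu : Measurable u)
    (hu0 : ∀ t, 0 ≤ t → 0 ≤ u t) (hH : 0 ≤ H) :
    stepLevel u ι H ∈ Icc 0 1 ∧
      ∫ t in (0 : ℝ)..H, waterLevel u ι (stepLevel u ι H) t = ι.vol := by
  set F : ℝ → ℝ := fun h => ∫ t in (0 : ℝ)..H, waterLevel u ι h t with hF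
  have hc : Continuous F := continuous_integral_waterLevel hu H
  have hmono : Monotone F := fun a b hab => intervalIntegral.integral_mono hH
    (intervalIntegrable_waterLevel hu a hH) (intervalIntegrable_waterLevel hu b hH)
    (waterLevel_mono hab)
  have hF0 : F 0 = 0 := by
    refine intervalIntegral.integral_zero_ae (Filter.Eventually.of_forall fun t ht => ?_)
    rw [uIoc_of_le hH] at ht
    have := hu0 t ht.1.le
    rw [waterLevel, max_eq_right (by linarith), min_eq_right ι.req_pos.le]
  have hclosed : IsClosed {h : ℝ | h ∈ Icc (0 : ℝ) 1 ∧ ι.vol ≤ F h} :=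
    isClosed_Icc.inter (isClosed_le continuous_const hc)
  have hbdd : BddBelow {h : ℝ | h ∈ Icc (0 : ℝ) 1 ∧ ι.vol ≤ F h} := ⟨0, fun h hh => hh.1.1⟩
  have hmem : stepLevel u ι H ∈ {h : ℝ | h ∈ Icc (0 : ℝ) 1 ∧ ι.vol ≤ F h} :=
    hclosed.csInf_mem ⟨1, ⟨zero_le_one, le_rfl⟩, hs⟩ hbdd
  refine ⟨hmem.1, le_antisymm ?_ hmem.2⟩
  obtain ⟨h, hh, hFh⟩ : ι.vol ∈ F '' Icc 0 1 :=
    intermediate_value_Icc zero_le_one hc.continuousOn ⟨hF0.trans_le ι.vol_nonneg, hs⟩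
  exact (hmono (csInf_le hbdd ⟨hh, hFh.ge⟩)).trans hFh.le

theorem IsBalanced.intervalIntegrable {V K T : ℝ} (hb : IsBalanced u V K) (hT : 0 ≤ T) :
    IntervalIntegrable u volume 0 T :=
  intervalIntegrable_of_bounded hb.measurable hT hb.nonneg hb.le_one

theorem IsBalanced.intervalIntegrable_excess {V K T : ℝ} (hb : IsBalanced u V K) (hT : 0 ≤ T)
    (y : ℝ) : IntervalIntegrable (fun t => max (u t - y) 0) volume 0 T :=
  intervalIntegrable_of_bounded (a := 0) (b := max (1 - y) 0)
    ((hb.measurable.sub_const y).max measurable_const) hT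
    (fun _ _ => le_max_right _ _) fun t ht => by
      have := hb.le_one t ht
      gcongr

theorem IsBalanced.volume_nonneg {V K : ℝ} (hb : IsBalanced u V K) (hK : 0 ≤ K) : 0 ≤ V := by
  rw [← hb.integral_eq K le_rfl]
  exact intervalIntegral.integral_nonneg hK fun t ht => hb.nonneg t ht.1

/-- On a balanced profile, a job fits in before `κ` times the optimal makespan: its requirement `r`
leaves out exactly the volume above the level `1 - r`. -/
theorem IsBalanced.stepSucceeds {V K H : ℝ} (hb : IsBalanced u V K) (hK : 0 ≤ K) (hKH : K ≤ H)
    (hH : ratio * (V + ι.vol) ≤ H) (hH' : ratio * ι.vol ≤ ι.req * H) : StepSucceeds u ι H := by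
  have hH0 : 0 ≤ H := hK.trans hKH
  have hr := ι.req_pos
  have hr1 := ι.req_le_one
  have heq : ∫ t in (0 : ℝ)..H, waterLevel u ι 1 t =
      ι.req * H - ∫ t in (0 : ℝ)..H, max (u t - (1 - ι.req)) 0 := by
    have : ∫ t in (0 : ℝ)..H, ι.req = ι.req * H := by simp [mul_comm]
    rw [← this, ← intervalIntegral.integral_sub (by simp) (hb.intervalIntegrable_excess hH0 _)]
    refine intervalIntegral.integral_congr fun t ht => ?_
    rw [uIcc_of_le hH0] at ht
    have := hb.le_one t ht.1
    simp only [waterLevel]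
    rw [max_eq_left (by linarith : 0 ≤ 1 - u t)]
    rcases le_total (u t) (1 - ι.req) with h | h
    · rw [min_eq_left (by linarith), max_eq_right (by linarith)]
      ring
    · rw [min_eq_right (by linarith), max_eq_left (by linarith)]
      ring
  have hex := hb.integral_excess_le H hKH (1 - ι.req) (by linarith) (by linarith)
  have hkey := ratio_mul_le_of_target ι.vol_nonneg hr hr1 hH hH'
  have h1 := ratio_mul_one_sub_exp_neg_one
  have h2 : Real.exp (-(1 - ι.req)) = Real.exp (-1) * Real.exp ι.req := by
    rw [← Real.exp_add]
    ring_nf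
  rw [excessBound, h2] at hex
  rw [StepSucceeds, heq]
  -- `1 = κ (1 - exp (-1))` turns the bound for the excess into the case `y = 1` of `hkey`
  have h3 : V * (1 - ratio * (1 - Real.exp (-1) * Real.exp ι.req)) + ι.vol =
      ratio * (V * Real.exp (-1) * (Real.exp ι.req - 1) + ι.vol * (1 - Real.exp (-1))) := by
    linear_combination (-V - ι.vol) * h1
  linarith

theorem add_waterLevel (h t : ℝ) :
    u t + waterLevel u ι h t = min (u t + ι.req) (max h (u t)) := by
  rw [waterLevel, ← min_add_add_left, ← max_add_add_left, add_sub_cancel, add_zero]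

theorem stepAssignment_of_lt {H t : ℝ} (ht : t < H) :
    stepAssignment u ι H t = waterLevel u ι (stepLevel u ι H) t := if_pos ht

theorem stepAssignment_of_le {H t : ℝ} (ht : H ≤ t) : stepAssignment u ι H t = 0 :=
  if_neg (not_lt.mpr ht)

theorem stepAssignment_nonneg (H t : ℝ) : 0 ≤ stepAssignment u ι H t := by
  unfold stepAssignment
  split_ifs
  exacts [waterLevel_nonneg _ _, le_rfl]

theorem stepAssignment_le_req (H t : ℝ) : stepAssignment u ι H t ≤ ι.req := by
  unfold stepAssignment
  split_ifs
  exacts [waterLevel_le_req _ _, ι.req_pos.le]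

theorem measurable_stepAssignment (hu : Measurable u) (H : ℝ) :
    Measurable (stepAssignment u ι H) :=
  Measurable.ite measurableSet_Iio (measurable_waterLevel hu _) measurable_const

/-- A function that vanishes from time `H` on has the same integral up to every later time. -/
theorem intervalIntegral_eq_of_eq_zero {f : ℝ → ℝ} {H T : ℝ} (hH : 0 ≤ H) (hHT : H ≤ T)
    (hf : IntervalIntegrable f volume 0 T) (h0 : ∀ t, 0 ≤ t → H ≤ t → f t = 0) :
    ∫ t in (0 : ℝ)..T, f t = ∫ t in (0 : ℝ)..H, f t := by
  have h1 : IntervalIntegrable f volume 0 H :=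
    hf.mono_set (by rw [uIcc_of_le hH, uIcc_of_le (hH.trans hHT)]; gcongr)
  rw [← sub_eq_zero, intervalIntegral.integral_interval_sub_left hf h1]
  refine intervalIntegral.integral_zero_ae (Filter.Eventually.of_forall fun t ht => ?_)
  rw [uIoc_of_le hHT] at ht
  exact h0 t (hH.trans ht.1.le) ht.1.le

theorem integral_stepAssignment {H : ℝ} (hH : 0 ≤ H) :
    ∫ t in (0 : ℝ)..H, stepAssignment u ι H t =
      ∫ t in (0 : ℝ)..H, waterLevel u ι (stepLevel u ι H) t := by
  refine intervalIntegral.integral_congr_Ioo_of_le hH fun t ht => ?_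
  exact stepAssignment_of_lt ht.2

/-- Water-filling preserves balance. For a level `y` between `r` and the water level, a point
lies above `y` afterwards exactly if it was above `y - r` before; all other levels are simpler. -/
theorem IsBalanced.add_stepAssignment {V K H : ℝ} (hb : IsBalanced u V K) (hK : 0 ≤ K)
    (hKH : K ≤ H) (hH : ratio * (V + ι.vol) ≤ H) (hH' : ratio * ι.vol ≤ ι.req * H) :
    IsBalanced (fun t => u t + stepAssignment u ι H t) (V + ι.vol) H := by
  have hH0 : 0 ≤ H := hK.trans hKH
  have hr := ι.req_pos
  have hv := ι.vol_nonneg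
  have hV : 0 ≤ V := hb.volume_nonneg hK
  have hκ : 0 < ratio := zero_lt_one.trans one_lt_ratio
  obtain ⟨hlev, hvol⟩ :=
    (hb.stepSucceeds hK hKH hH hH').stepLevel_spec hb.measurable hb.nonneg hH0
  rw [← integral_stepAssignment hH0] at hvol
  set h := stepLevel u ι H with hh
  set u' : ℝ → ℝ := fun t => u t + stepAssignment u ι H t with hu'
  have hsa := measurable_stepAssignment (ι := ι) hb.measurable H
  have hm : Measurable u' := hb.measurable.add hsa
  have hsi : ∀ T, 0 ≤ T → IntervalIntegrable (stepAssignment u ι H) volume 0 T := fun T hT =>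
    intervalIntegrable_of_bounded hsa hT (fun _ _ => stepAssignment_nonneg _ _)
      (fun _ _ => stepAssignment_le_req _ _)
  have hlt : ∀ t, t < H → u' t = min (u t + ι.req) (max h (u t)) := fun t ht => by
    rw [hu', ← add_waterLevel]
    simp only [stepAssignment_of_lt ht, hh]
  have h0 : ∀ t, 0 ≤ t → 0 ≤ u' t := fun t ht =>
    add_nonneg (hb.nonneg t ht) (stepAssignment_nonneg _ _)
  have hz : ∀ t, 0 ≤ t → H ≤ t → u' t = 0 := fun t ht htH => by
    simp [hu', hb.eq_zero t ht (hKH.trans htH), stepAssignment_of_le htH]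
  have h1 : ∀ t, 0 ≤ t → u' t ≤ 1 := fun t ht => by
    rcases lt_or_ge t H with htH | htH
    · rw [hlt t htH]
      exact (min_le_right _ _).trans (max_le hlev.2 (hb.le_one t ht))
    · rw [hz t ht htH]
      exact zero_le_one
  have hi : ∀ T, 0 ≤ T → IntervalIntegrable u' volume 0 T := fun T hT =>
    (hb.intervalIntegrable hT).add (hsi T hT)
  have hint : ∫ t in (0 : ℝ)..H, u' t = V + ι.vol := by
    rw [hu', intervalIntegral.integral_add (hb.intervalIntegrable hH0) (hsi H hH0),
      hb.integral_eq H hKH, hvol]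
  refine ⟨hm, h0, h1, hz, fun T hT => ?_, fun T hT y hy0 hy1 => ?_⟩
  · rw [intervalIntegral_eq_of_eq_zero hH0 hT (hi T (hH0.trans hT)) hz, hint]
  have hei : IntervalIntegrable (fun t => max (u' t - y) 0) volume 0 T :=
    intervalIntegrable_of_bounded (a := 0) (b := max (1 - y) 0)
      ((hm.sub_const y).max measurable_const) (hH0.trans hT)
      (fun _ _ => le_max_right _ _) fun t ht => by
        have := h1 t ht
        gcongr
  rw [intervalIntegral_eq_of_eq_zero hH0 hT hei fun t ht htH => by
    rw [hz t ht htH]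
    exact max_eq_right (by linarith)]
  have hconst : ∀ a : ℝ, ∫ _ in (0 : ℝ)..H, a = a * H := fun a => by simp [mul_comm]
  rcases le_or_gt h y with hhy | hhy
  · -- above the water level nothing changes
    calc ∫ t in (0 : ℝ)..H, max (u' t - y) 0 = ∫ t in (0 : ℝ)..H, max (u t - y) 0 := by
          refine intervalIntegral.integral_congr_Ioo_of_le hH0 fun t ht => ?_
          simp only [hlt t ht.2]
          rcases le_total (u t) y with h3 | h3
          · have h4 := (min_le_right (u t + ι.req) (max h (u t))).trans (max_le hhy h3)
            rw [max_eq_right (sub_nonpos.mpr h4), max_eq_right (sub_nonpos.mpr h3)]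
          · rw [max_eq_right (hhy.trans h3), min_eq_right (by linarith)]
      _ ≤ V * excessBound y := hb.integral_excess_le H hKH y hy0 hy1
      _ ≤ (V + ι.vol) * excessBound y := by
          have := excessBound_nonneg hy1
          gcongr
          linarith
  rcases lt_or_ge y ι.req with hyr | hyr
  · -- before time `H`, the whole profile lies above `y`
    have : ∫ t in (0 : ℝ)..H, max (u' t - y) 0 = V + ι.vol - y * H := by
      rw [← hint, ← hconst y, ← intervalIntegral.integral_sub (hi H hH0) (by simp)]
      refine intervalIntegral.integral_congr_Ioo_of_le hH0 fun t ht => max_eq_left ?_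
      have hut := hb.nonneg t ht.1.le
      rw [hlt t ht.2, sub_nonneg]
      exact le_min (by linarith) (hhy.le.trans (le_max_left _ _))
    rw [this, excessBound]
    have he : 1 - Real.exp (-y) ≤ y := by linarith [Real.add_one_le_exp (-y)]
    have e1 : (V + ι.vol) * ratio * (1 - Real.exp (-y)) ≤ (V + ι.vol) * ratio * y := by
      gcongr
    have e2 : ratio * (V + ι.vol) * y ≤ H * y := by gcongr
    linarith
  · have hri : IntervalIntegrable (fun _ : ℝ => ι.req) volume 0 H := by simp
    have : ∫ t in (0 : ℝ)..H, max (u' t - y) 0 =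
        ι.vol - ι.req * H + ∫ t in (0 : ℝ)..H, max (u t - (y - ι.req)) 0 := by
      rw [← hvol, ← hconst, ← intervalIntegral.integral_sub (hsi H hH0) hri,
        ← intervalIntegral.integral_add ((hsi H hH0).sub hri) (hb.intervalIntegrable_excess hH0 _)]
      refine intervalIntegral.integral_congr_Ioo_of_le hH0 fun t ht => ?_
      have hs : stepAssignment u ι H t = u' t - u t := by simp [hu']
      simp only [hs, hlt t ht.2]
      rcases le_total (u t) (y - ι.req) with h3 | h3
      · rw [min_eq_left (by linarith [le_max_left h (u t)]), max_eq_right (by linarith),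
          max_eq_right (by linarith)]
        ring
      · have h4 : y ≤ min (u t + ι.req) (max h (u t)) :=
          le_min (by linarith) (hhy.le.trans (le_max_left _ _))
        rw [max_eq_left (sub_nonneg.mpr h4), max_eq_left (sub_nonneg.mpr h3)]
        ring
    have hex := hb.integral_excess_le H hKH (y - ι.req) (by linarith) (by linarith)
    have hkey := ratio_mul_le_of_target hv hr hyr hH hH'
    have he : Real.exp (-(y - ι.req)) = Real.exp (-y) * Real.exp ι.req := by
      rw [← Real.exp_add]
      ring_nf
    rw [excessBound, he] at hex
    rw [this, excessBound]
    linarith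

end Step

theorem isBalanced_nil : IsBalanced (fun _ => 0) 0 0 where
  measurable := measurable_const
  nonneg _ _ := le_rfl
  le_one _ _ := zero_le_one
  eq_zero _ _ _ := rfl
  integral_eq _ _ := by simp
  integral_excess_le T hT y hy _ := by simp [hy]

theorem ratio_mul_totalVol_le_targetTime (past : List Job) (ι : Job) :
    ratio * (totalVol past + ι.vol) ≤ targetTime ratio past ι := by
  rw [← totalVol_append_singleton]
  exact mul_le_mul_of_nonneg_left (totalVol_le_optMakespan _)
    (zero_lt_one.trans one_lt_ratio).le

theorem ratio_mul_vol_le_targetTime (past : List Job) (ι : Job) :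
    ratio * ι.vol ≤ ι.req * targetTime ratio past ι := by
  rw [targetTime, mul_left_comm]
  exact mul_le_mul_of_nonneg_left (vol_le_req_mul_optMakespan _ (by simp))
    (zero_lt_one.trans one_lt_ratio).le

theorem ratio_mul_optMakespan_nonneg (J : List Job) : 0 ≤ ratio * (optMakespan J).toReal :=
  mul_nonneg (zero_lt_one.trans one_lt_ratio).le ENNReal.toReal_nonneg

theorem ratio_mul_optMakespan_le_targetTime (past : List Job) (ι : Job) :
    ratio * (optMakespan past).toReal ≤ targetTime ratio past ι :=
  mul_le_mul_of_nonneg_left (optMakespan_append_mono _ _) (zero_lt_one.trans one_lt_ratio).le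

theorem isBalanced_waterFilling (past : List Job) :
    IsBalanced (OnlineAlgorithm.schedule (waterFilling ratio) past).usage (totalVol past)
      (ratio * (optMakespan past).toReal) := by
  induction past using List.reverseRecOn with
  | nil =>
    have h : (optMakespan []).toReal = 0 := by
      have := optMakespan_le [] le_rfl (by simp [totalVol]) (by simp)
      simp_all
    have h0 : (OnlineAlgorithm.schedule (waterFilling ratio) []).usage = fun _ => 0 :=
      funext fun t => Finset.sum_eq_zero fun j _ => j.elim0
    rw [h, h0, mul_zero]
    exact isBalanced_nil
  | append_singleton past ι ih =>
    have h := ih.add_stepAssignment (ratio_mul_optMakespan_nonneg past)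
      (ratio_mul_optMakespan_le_targetTime past ι) (ratio_mul_totalVol_le_targetTime past ι)
      (ratio_mul_vol_le_targetTime past ι)
    rw [totalVol_append_singleton]
    have hu : (OnlineAlgorithm.schedule (waterFilling ratio) (past ++ [ι])).usage = fun t =>
        (OnlineAlgorithm.schedule (waterFilling ratio) past).usage t +
          stepAssignment (OnlineAlgorithm.schedule (waterFilling ratio) past).usage ι
            (targetTime ratio past ι) t := funext fun t => by
      rw [usage_schedule_append_singleton, waterFilling_eq]
    rw [hu]
    exact h

theorem stepSucceeds_waterFilling (past : List Job) (ι : Job) :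
    StepSucceeds (OnlineAlgorithm.schedule (waterFilling ratio) past).usage ι
      (targetTime ratio past ι) :=
  (isBalanced_waterFilling past).stepSucceeds (ratio_mul_optMakespan_nonneg past)
    (ratio_mul_optMakespan_le_targetTime past ι) (ratio_mul_totalVol_le_targetTime past ι)
    (ratio_mul_vol_le_targetTime past ι)

theorem targetTime_nonneg (past : List Job) (ι : Job) : 0 ≤ targetTime ratio past ι :=
  ratio_mul_optMakespan_nonneg _

theorem integrableOn_waterFilling (past : List Job) (ι : Job) :
    IntegrableOn (waterFilling ratio past ι) (Ici 0) := by
  rw [waterFilling_eq]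
  set u := (OnlineAlgorithm.schedule (waterFilling ratio) past).usage
  set H := targetTime ratio past ι
  have hm : Measurable (stepAssignment u ι H) :=
    measurable_stepAssignment (isBalanced_waterFilling past).measurable H
  have h : IntegrableOn (stepAssignment u ι H) (Ico 0 H) := by
    refine Measure.integrableOn_of_bounded (M := ι.req) (by simp) hm.aestronglyMeasurable ?_
    refine Filter.Eventually.of_forall fun t => ?_
    rw [Real.norm_of_nonneg (stepAssignment_nonneg _ _)]
    exact stepAssignment_le_req _ _
  refine h.of_forall_sdiff_eq_zero measurableSet_Ici fun t ht => stepAssignment_of_le ?_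
  by_contra! hlt
  exact ht.2 ⟨ht.1, hlt⟩

theorem vol_le_integral_waterFilling (past : List Job) (ι : Job) :
    ι.vol ≤ ∫ t in Ici 0, waterFilling ratio past ι t := by
  have hb := isBalanced_waterFilling past
  have hH := targetTime_nonneg past ι
  have hvol := ((stepSucceeds_waterFilling past ι).stepLevel_spec hb.measurable hb.nonneg hH).2
  rw [← integral_stepAssignment hH, ← waterFilling_eq, intervalIntegral.integral_of_le hH] at hvol
  rw [← hvol]
  refine setIntegral_mono_set (integrableOn_waterFilling past ι) ?_
    (LE.le.eventuallyLE fun t ht => ht.1.le)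
  refine Filter.Eventually.of_forall fun t => ?_
  rw [waterFilling_eq]
  exact stepAssignment_nonneg _ _

theorem isCompetitive_waterFilling : OnlineAlgorithm.IsCompetitive (waterFilling ratio) ratio := by
  intro J
  refine ⟨⟨fun j => integrableOn_waterFilling _ _, fun j t _ => ?_,
    (isBalanced_waterFilling J).le_one, fun j t _ => ?_,
    fun j => vol_le_integral_waterFilling _ _⟩, iSup_le fun j => ?_⟩
  · simp only [OnlineAlgorithm.schedule]
    rw [waterFilling_eq]
    exact stepAssignment_nonneg _ _
  · simp only [OnlineAlgorithm.schedule]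
    rw [waterFilling_eq]
    exact stepAssignment_le_req _ _
  · rw [← ENNReal.ofReal_toReal (optMakespan_ne_top J),
      ← ENNReal.ofReal_mul (zero_lt_one.trans one_lt_ratio).le]
    refine completionTime_le fun t ht => le_of_eq ?_
    simp only [OnlineAlgorithm.schedule]
    rw [waterFilling_eq]
    refine stepAssignment_of_le (le_trans ?_ ht.le)
    have hJ : J = J.take j ++ [J.get j] ++ J.drop (j + 1) := by simp
    refine mul_le_mul_of_nonneg_left ?_ (zero_lt_one.trans one_lt_ratio).le
    conv_rhs => rw [hJ]
    exact optMakespan_append_mono _ _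

/-! ### The lower bound -/

@[simp]
theorem length_harmonicJobs (n : ℕ) : (harmonicJobs n).length = n := by
  simp [harmonicJobs]

theorem getElem_harmonicJobs_vol {n i : ℕ} (h : i < (harmonicJobs n).length) :
    (harmonicJobs n)[i].vol = 1 / n := by
  simp [harmonicJobs]

theorem getElem_harmonicJobs_req {n i : ℕ} (h : i < (harmonicJobs n).length) :
    (harmonicJobs n)[i].req = 1 / ((i : ℝ) + 1) := by
  simp [harmonicJobs]

theorem optMakespan_take_harmonicJobs_le {n k : ℕ} (hk : k ≤ n) :
    optMakespan ((harmonicJobs n).take k) ≤ ENNReal.ofReal (k / n) := by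
  refine optMakespan_le _ (by positivity) ?_ fun ι hι => ?_
  · rw [← sum_vol_eq_totalVol]
    simp [getElem_harmonicJobs_vol, hk, div_eq_mul_inv]
  · obtain ⟨i, hi, rfl⟩ := List.mem_iff_getElem.mp hι
    rw [List.getElem_take, getElem_harmonicJobs_vol, getElem_harmonicJobs_req]
    have hik : (i : ℝ) + 1 ≤ k := by
      rw [List.length_take] at hi
      exact_mod_cast (lt_min_iff.mp hi).1
    rw [one_div_mul_eq_div, div_right_comm]
    gcongr
    exact (one_le_div (by positivity)).mpr hik

/-- An online algorithm that is `c`-competitive on all prefixes of the harmonic jobs finishes the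
`j`-th job by time `c * j / n`. What all the jobs must then receive up to time `c - 1` is at
most `c - 1`. The jobs are split at `m`, the last one that has to be finished by time `c - 1`. -/
theorem sum_harmonic_le {A : OnlineAlgorithm} {c : ℝ} (hc : 1 ≤ c) {n m : ℕ} (hmn : m ≤ n)
    (hn : 0 < n)
    (hA : IsFeasible (harmonicJobs n) (A.schedule (harmonicJobs n)))
    (hA' : ∀ k ≤ n, IsFeasible ((harmonicJobs n).take k) (A.schedule ((harmonicJobs n).take k)))
    (hm : c * m / n ≤ c - 1) (hm' : c - 1 ≤ c * (m + 1) / n)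
    (h : ∀ k ≤ n, (A.schedule ((harmonicJobs n).take k)).makespan ≤
      ENNReal.ofReal c * optMakespan ((harmonicJobs n).take k)) :
    c * m / n + (c - 1) * ∑ i ∈ Finset.Ico m n, 1 / ((i : ℝ) + 1) ≤ 2 * (c - 1) := by
  set T := c - 1 with hT
  have hT0 : 0 ≤ T := by linarith
  have hn' : (0 : ℝ) < n := by exact_mod_cast hn
  set R := A.schedule (harmonicJobs n) with hR
  have hz : ∀ (j : Fin (harmonicJobs n).length) (t : ℝ), 0 ≤ t → c * (j + 1) / n < t →
      R j t = 0 := by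
    intro j t _ ht
    have hjn : (j : ℕ) + 1 ≤ n := by simpa using j.2
    have hlen : (j : ℕ) < ((harmonicJobs n).take (j + 1)).length := by
      rw [List.length_take]
      exact lt_min (Nat.lt_succ_self _) j.2
    have hB : (A.schedule ((harmonicJobs n).take (j + 1))).makespan ≤
        ENNReal.ofReal (c * (j + 1) / n) := by
      refine (h _ hjn).trans ?_
      rw [mul_div_assoc, ENNReal.ofReal_mul (by linarith)]
      gcongr
      simpa using optMakespan_take_harmonicJobs_le hjn
    have := eq_zero_of_makespan_le (hA' _ hjn) (by positivity) hB ⟨j, hlen⟩ ht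
    rw [← this]
    simp [hR, OnlineAlgorithm.schedule, List.take_take]
  have hjob : ∀ j : Fin (harmonicJobs n).length,
      1 / (n : ℝ) - 1 / ((j : ℝ) + 1) * max (c * (j + 1) / n - T) 0 ≤ ∫ t in Icc 0 T, R j t := by
    intro j
    have h1 := hA.vol_le j
    have h2 := setIntegral_Ici_le_add (r := 1 / ((j : ℝ) + 1)) (hA.integrable j) (by positivity)
      hT0 (fun t ht => (hA.le_req j t ht).trans_eq (getElem_harmonicJobs_req _)) (hz j)
    rw [List.get_eq_getElem, getElem_harmonicJobs_vol] at h1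
    linarith
  have hint : ∀ j, IntegrableOn (R j) (Icc 0 T) := fun j =>
    (hA.integrable j).mono_set Icc_subset_Ici_self
  have hsum : ∑ j : Fin (harmonicJobs n).length,
      (1 / (n : ℝ) - 1 / ((j : ℝ) + 1) * max (c * (j + 1) / n - T) 0) ≤ T := by
    calc _ ≤ ∑ j, ∫ t in Icc 0 T, R j t := Finset.sum_le_sum fun j _ => hjob j
      _ = ∫ t in Icc 0 T, R.usage t := (integral_finsetSum _ fun j _ => hint j).symm
      _ ≤ ∫ t in Icc 0 T, (1 : ℝ) :=
          setIntegral_mono_on (integrable_finsetSum _ fun j _ => hint j)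
            (integrableOn_const (by simp)) measurableSet_Icc
            fun t ht => hA.usage_le_one t ht.1
      _ = T := by simp [hT0]
  rw [Fin.sum_univ_eq_sum_range
    (fun j : ℕ => 1 / (n : ℝ) - 1 / ((j : ℝ) + 1) * max (c * (j + 1) / n - T) 0),
    length_harmonicJobs, ← Finset.sum_range_add_sum_Ico _ hmn] at hsum
  have hs1 : ∑ j ∈ Finset.range m,
      (1 / (n : ℝ) - 1 / ((j : ℝ) + 1) * max (c * (j + 1) / n - T) 0) = m / n := by
    rw [Finset.sum_congr rfl (g := fun _ => 1 / (n : ℝ)) fun j hj => ?_]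
    · simp [div_eq_mul_inv]
    · have hjm : (j : ℝ) + 1 ≤ m := by exact_mod_cast Finset.mem_range.mp hj
      have : c * ((j : ℝ) + 1) / n ≤ c * m / n := by gcongr
      rw [max_eq_right (by linarith)]
      ring
  have hs2 : ∑ j ∈ Finset.Ico m n,
      (1 / (n : ℝ) - 1 / ((j : ℝ) + 1) * max (c * (j + 1) / n - T) 0) =
      T * ∑ i ∈ Finset.Ico m n, 1 / ((i : ℝ) + 1) - T * (1 - m / n) := by
    have : T * (1 - m / n) = ∑ i ∈ Finset.Ico m n, T / n := by
      rw [Finset.sum_const, Nat.card_Ico, nsmul_eq_mul, Nat.cast_sub hmn]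
      field_simp
    rw [this, Finset.mul_sum, ← Finset.sum_sub_distrib]
    refine Finset.sum_congr rfl fun j hj => ?_
    have hjm : (m : ℝ) + 1 ≤ j + 1 := by exact_mod_cast Nat.succ_le_succ (Finset.mem_Ico.mp hj).1
    have : c * ((m : ℝ) + 1) / n ≤ c * (j + 1) / n := by gcongr
    rw [max_eq_left (by linarith)]
    field_simp
    rw [hT]
    ring
  rw [hs1, hs2] at hsum
  have : c * m / n = T * (m / n) + m / n := by rw [hT]; ring
  linarith

theorem log_sub_log_le_sum_Ico {m n : ℕ} (hmn : m ≤ n) :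
    Real.log (n + 1) - Real.log (m + 1) ≤ ∑ i ∈ Finset.Ico m n, 1 / ((i : ℝ) + 1) := by
  induction n, hmn using Nat.le_induction with
  | base => simp
  | succ n hmn ih =>
    rw [Finset.sum_Ico_succ_top hmn]
    have hn : (0 : ℝ) < (n : ℝ) + 1 := by positivity
    have h := Real.log_le_sub_one_of_pos (x := ((n : ℝ) + 1 + 1) / (n + 1)) (by positivity)
    rw [Real.log_div (by positivity) (by positivity)] at h
    have : ((n : ℝ) + 1 + 1) / (n + 1) - 1 = 1 / (n + 1) := by field_simp; ring
    push_cast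
    linarith

/-- The limiting form of `sum_harmonic_le`: `log (c / (c - 1)) > 1` for `c < e / (e - 1)`. -/
theorem eventually_harmonic_lower_bound {c : ℝ} (hc : 1 < c) (hc' : c < ratio) :
    ∃ N : ℕ, ∀ n : ℕ, N ≤ n → 2 * (c - 1) <
      (c - 1) - c / n - (c - 1) * Real.log ((c - 1) / c + 1 / n) := by
  have hlim : Filter.Tendsto (fun n : ℕ =>
      (c - 1) - c / (n : ℝ) - (c - 1) * Real.log ((c - 1) / c + 1 / (n : ℝ))) Filter.atTop
      (nhds ((c - 1) - 0 - (c - 1) * Real.log ((c - 1) / c + 0))) := by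
    have hne : (c - 1) / c + 0 ≠ 0 := by
      rw [add_zero]
      exact (div_pos (by linarith) (by linarith)).ne'
    refine (tendsto_const_nhds.sub (tendsto_const_div_atTop_nhds_zero_nat c)).sub
      (tendsto_const_nhds.mul (Filter.Tendsto.log ?_ hne))
    exact tendsto_const_nhds.add (tendsto_const_div_atTop_nhds_zero_nat 1)
  have hlog : Real.log ((c - 1) / c) < -1 := by
    rw [Real.log_lt_iff_lt_exp (div_pos (by linarith) (by linarith)), div_lt_iff₀ (by linarith)]
    have h := ratio_mul_one_sub_exp_neg_one
    have h1 : Real.exp (-1) < 1 := by simp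
    nlinarith
  have hlt : 2 * (c - 1) < (c - 1) - 0 - (c - 1) * Real.log ((c - 1) / c + 0) := by
    rw [add_zero]
    nlinarith
  exact Filter.eventually_atTop.mp (hlim.eventually (lt_mem_nhds hlt))

theorem exists_not_competitive_of_one_lt {c : ℝ} (hc : 1 < c) (hc' : c < ratio) :
    ∃ N : ℕ, ∀ n : ℕ, N ≤ n → ∀ A : OnlineAlgorithm, (∀ J, IsFeasible J (A.schedule J)) →
      ∃ k ≤ n, ENNReal.ofReal c * optMakespan ((harmonicJobs n).take k) <
        (A.schedule ((harmonicJobs n).take k)).makespan := by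
  obtain ⟨N, hN⟩ := eventually_harmonic_lower_bound hc hc'
  refine ⟨max N 1, fun n hn A hA => ?_⟩
  by_contra! hcon
  have hn1 : 0 < n := (le_max_right N 1).trans hn
  have hn' : (0 : ℝ) < n := by exact_mod_cast hn1
  have hc0 : 0 < c := by linarith
  -- the jobs up to `m` have to be finished by time `c - 1`
  set m := ⌊(c - 1) * n / c⌋₊ with hm
  have hm1 : (m : ℝ) ≤ (c - 1) * n / c := by
    refine Nat.floor_le ?_
    have : 0 ≤ c - 1 := by linarith
    positivity
  have hm2 : (c - 1) * n / c < m + 1 := Nat.lt_floor_add_one _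
  rw [le_div_iff₀ hc0] at hm1
  rw [div_lt_iff₀ hc0] at hm2
  have hmn : m ≤ n := by
    have : (m : ℝ) ≤ n := by nlinarith
    exact_mod_cast this
  have hsum := sum_harmonic_le hc.le hmn hn1 (hA _) (fun k _ => hA _)
    (by rw [div_le_iff₀ hn']; linarith) (by rw [le_div_iff₀ hn']; linarith) hcon
  have h1 : (c - 1) - c / n ≤ c * m / n := by
    rw [sub_le_iff_le_add, ← add_div, le_div_iff₀ hn']
    linarith
  have h2 : Real.log n - Real.log (m + 1) ≤ ∑ i ∈ Finset.Ico m n, 1 / ((i : ℝ) + 1) := by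
    refine le_trans ?_ (log_sub_log_le_sum_Ico hmn)
    gcongr
    linarith
  have h3 : Real.log (m + 1) - Real.log n ≤ Real.log ((c - 1) / c + 1 / n) := by
    rw [← Real.log_div (by positivity) hn'.ne']
    refine Real.log_le_log (by positivity) ?_
    rw [add_div]
    refine add_le_add_left ?_ _
    rw [div_le_div_iff₀ hn' hc0]
    exact hm1
  have h4 := hN n ((le_max_left N 1).trans hn)
  have h5 : (c - 1) * -Real.log ((c - 1) / c + 1 / n) ≤
      (c - 1) * ∑ i ∈ Finset.Ico m n, 1 / ((i : ℝ) + 1) :=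
    mul_le_mul_of_nonneg_left (by linarith) (by linarith)
  linarith

theorem exists_not_competitive {c : ℝ} (hc : c < ratio) :
    ∃ N : ℕ, ∀ n : ℕ, N ≤ n → ∀ A : OnlineAlgorithm, (∀ J, IsFeasible J (A.schedule J)) →
      ∃ k ≤ n, ENNReal.ofReal c * optMakespan ((harmonicJobs n).take k) <
        (A.schedule ((harmonicJobs n).take k)).makespan := by
  obtain ⟨c', h1, h2⟩ := exists_between (max_lt hc one_lt_ratio)
  rw [max_lt_iff] at h1
  obtain ⟨N, hN⟩ := exists_not_competitive_of_one_lt h1.2 h2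
  refine ⟨N, fun n hn A hA => ?_⟩
  obtain ⟨k, hk, hlt⟩ := hN n hn A hA
  refine ⟨k, hk, lt_of_le_of_lt ?_ hlt⟩
  gcongr
  exact h1.1.le

theorem ratio_le_of_isCompetitive {A : OnlineAlgorithm} {c : ℝ} (hA : A.IsCompetitive c) :
    ratio ≤ c := by
  by_contra! hc
  obtain ⟨N, hN⟩ := exists_not_competitive hc
  obtain ⟨k, -, hk⟩ := hN N le_rfl A fun J => (hA J).1
  exact absurd (hA _).2 (not_le.mpr hk)

end SharedResource

theorem mainTheorem1 :
    -- all water-filling steps with target times `e / (e - 1) * M*` succeed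
    (∀ (past : List SharedResource.Job) (ι : SharedResource.Job),
      SharedResource.StepSucceeds
        (SharedResource.OnlineAlgorithm.schedule
          (SharedResource.waterFilling (Real.exp 1 / (Real.exp 1 - 1))) past).usage
        ι (SharedResource.targetTime (Real.exp 1 / (Real.exp 1 - 1)) past ι)) ∧
    -- the water-filling algorithm has competitive ratio `e / (e - 1)`
    SharedResource.OnlineAlgorithm.HasCompetitiveRatio
      (SharedResource.waterFilling (Real.exp 1 / (Real.exp 1 - 1)))
      (Real.exp 1 / (Real.exp 1 - 1)) ∧
    -- no deterministic online algorithm has a smaller competitive ratio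
    (∀ (A : SharedResource.OnlineAlgorithm) (c : ℝ), A.IsCompetitive c →
      Real.exp 1 / (Real.exp 1 - 1) ≤ c) ∧
    -- and this is witnessed by the prefixes of the jobs with `v_j = 1 / n`, `r_j = 1 / j`
    (∀ c : ℝ, c < Real.exp 1 / (Real.exp 1 - 1) → ∃ N : ℕ, ∀ n : ℕ, N ≤ n →
      ∀ A : SharedResource.OnlineAlgorithm,
        (∀ J : List SharedResource.Job, SharedResource.IsFeasible J (A.schedule J)) →
        ∃ k : ℕ, k ≤ n ∧
          ENNReal.ofReal c *
              SharedResource.optMakespan ((SharedResource.harmonicJobs n).take k) <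
            (A.schedule ((SharedResource.harmonicJobs n).take k)).makespan) :=
  ⟨SharedResource.stepSucceeds_waterFilling,
    ⟨SharedResource.isCompetitive_waterFilling,
      fun _ hc => SharedResource.ratio_le_of_isCompetitive hc⟩,
    fun _ _ hA => SharedResource.ratio_le_of_isCompetitive hA,
    fun _ hc => SharedResource.exists_not_competitive hc⟩
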